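/- Let $N\ge 3$ and $1\le k\le N-2$ be integers, and let $X_1,\dots,X_N$ be independent random variables, each uniformly distributed on $[0,1]$, with order statistics $X_{(1)}\le\dots\le X_{(N)}$. Consider the $N-1$ inner spacings $X_{(j+1)}-X_{(j)}$, $1\le j\le N-1$ (the endpoints $0$ and $1$ are not counted as data points), and let $s_k$ be the sum of the $k$ smallest of them. Put $$A(k,M)=\frac{M\,(M+1)!}{(M+1-k)^{k-1}\,(M+1-k)!},\qquad a(i,k)=\frac{(-1)^{i-1}(k+1-i)^{k-2}}{(k-i)!\,(i-1)!},$$ and let $H(x,a,b)=1$ if $a\le x\le b$ and $H(x,a,b)=0$ otherwise. Then $s_k$ has the (nonnegative) probability density, with respect to Lebesgue measure on $\mathbb R$, $$f(s)=\frac{N}{N-2}\,A(k,N-2)\sum_{i=1}^{k}a(i,k)\left[1-\frac{N-i}{k+1-i}\,s\right]^{N-1}H\!\left(s,0,\frac{k+1-i}{N-i}\right),$$ and for every $s\ge 0$ this density also equals $$f(s)=N(N-1)\,A(k,N-2)\sum_{i=1}^{k}\int_{\frac{(N-i)s}{k+1-i}}^{1}a(i,k)\,(1-\mu)\left[\mu-\frac{N-i}{k+1-i}\,s\right]^{N-3}d\mu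 ,$$ where an integral whose lower limit exceeds $1$ is read as $0$. Moreover, for every $s\ge 0$, $$\mathbb P(s_k\le s)=\frac{A(k,N-2)}{N-2}\sum_{i=1}^{k}\frac{a(i,k)\,(k+1-i)}{N-i}\left(1-\left[1-\frac{N-i}{k+1-i}\,s\right]^{N}H\!\left(s,0,\frac{k+1-i}{N-i}\right)\right),$$ and $\mathbb P(s_k\le s)=0$ for $s<0$. -/

import Mathlib

open MeasureTheory ProbabilityTheory
open scoped Nat

noncomputable section

/-- The values of a finite real sample arranged in nondecreasing order:
`orderStat x 0 ≤ orderStat x 1 ≤ …` (positions are counted from `0`). -/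
def orderStat {n : ℕ} (x : Fin n → ℝ) : Fin n → ℝ :=
  x ∘ Tuple.sort x

/-- The `N - 1` inner spacings (gaps between consecutive ordered values) of `N` real values;
the endpoints `0` and `1` are not counted as data. -/
def innerSpacing {N : ℕ} (x : Fin N → ℝ) (j : Fin (N - 1)) : ℝ :=
  orderStat x ⟨j.val + 1, by omega⟩ - orderStat x ⟨j.val, by omega⟩

/-- The sum of the `k` smallest entries of a finite family (with multiplicity). -/
def sumSmallest {n : ℕ} (k : ℕ) (g : Fin n → ℝ) : ℝ :=
  ∑ j : Fin n with j.val < k, orderStat g j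

/-- `H(x, a, b) = 1` if `a ≤ x ≤ b`, and `0` otherwise. -/
def boxH (x a b : ℝ) : ℝ :=
  (Set.Icc a b).indicator (fun _ => 1) x

/-- `A(k, M) = M (M+1)! / ((M+1-k)^(k-1) (M+1-k)!)`, for `1 ≤ k ≤ M`. -/
def coeffA (k M : ℕ) : ℝ :=
  (M : ℝ) * ((M + 1)! : ℝ) / (((M : ℝ) + 1 - k) ^ (k - 1) * ((M + 1 - k)! : ℝ))

/-- `a(i, k) = (-1)^(i-1) (k+1-i)^(k-2) / ((k-i)! (i-1)!)`, for `1 ≤ i ≤ k`; the exponent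
`k - 2` is an integer (it is `-1` for `k = 1`). -/
def coeffa (i k : ℕ) : ℝ :=
  (-1 : ℝ) ^ (i - 1) * ((k : ℝ) + 1 - i) ^ ((k : ℤ) - 2) / (((k - i)! : ℝ) * ((i - 1)! : ℝ))

/-- The closed form of the density of the sum of the `k` smallest inner spacings. -/
def noEdgePdf (N k : ℕ) (s : ℝ) : ℝ :=
  (N : ℝ) / ((N : ℝ) - 2) * coeffA k (N - 2) *
    ∑ i ∈ Finset.Icc 1 k,
      coeffa i k * (1 - (((N : ℝ) - i) / ((k : ℝ) + 1 - i)) * s) ^ (N - 1) *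
        boxH s 0 (((k : ℝ) + 1 - i) / ((N : ℝ) - i))

/-- The integral form of the same density; the integral over an empty range, i.e. when
the lower limit exceeds `1`, is `0`. -/
def noEdgePdfIntegral (N k : ℕ) (s : ℝ) : ℝ :=
  (N : ℝ) * ((N : ℝ) - 1) * coeffA k (N - 2) *
    ∑ i ∈ Finset.Icc 1 k,
      ∫ m in Set.Icc ((((N : ℝ) - i) * s) / ((k : ℝ) + 1 - i)) 1,
        coeffa i k * (1 - m) * (m - (((N : ℝ) - i) / ((k : ℝ) + 1 - i)) * s) ^ (N - 3)

/-- The closed form, on `s ≥ 0`, of the distribution function of the sum of the `k` smallest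
inner spacings. -/
def noEdgeCdf (N k : ℕ) (s : ℝ) : ℝ :=
  coeffA k (N - 2) / ((N : ℝ) - 2) *
    ∑ i ∈ Finset.Icc 1 k,
      coeffa i k * ((k : ℝ) + 1 - i) / ((N : ℝ) - i) *
        (1 - (1 - (((N : ℝ) - i) / ((k : ℝ) + 1 - i)) * s) ^ N *
          boxH s 0 (((k : ℝ) + 1 - i) / ((N : ℝ) - i)))

end

lemma hasDerivAt_max_zero_pow {n : ℕ} (hn : 1 ≤ n) (x : ℝ) :
    HasDerivAt (fun y : ℝ => (max y 0) ^ (n + 1)) ((n + 1 : ℝ) * (max x 0) ^ n) x := by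
  have hne : ∀ y : ℝ, y ≠ 0 →
      HasDerivAt (fun y : ℝ => (max y 0) ^ (n + 1)) ((n + 1 : ℝ) * (max y 0) ^ n) y := by
    intro y hy
    rcases lt_or_gt_of_ne hy with h | h
    · have : (fun y : ℝ => (max y 0) ^ (n + 1)) =ᶠ[nhds y] fun _ => 0 := by
        filter_upwards [Iio_mem_nhds h] with z hz
        rw [max_eq_right (le_of_lt hz), zero_pow (Nat.succ_ne_zero n)]
      rw [max_eq_right h.le, zero_pow (by omega), mul_zero]
      exact (hasDerivAt_const y (0 : ℝ)).congr_of_eventuallyEq this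
    · have : (fun y : ℝ => (max y 0) ^ (n + 1)) =ᶠ[nhds y] fun z => z ^ (n + 1) := by
        filter_upwards [Ioi_mem_nhds h] with z hz
        rw [max_eq_left (le_of_lt hz)]
      rw [max_eq_left h.le]
      refine HasDerivAt.congr_of_eventuallyEq ?_ this
      simpa using hasDerivAt_pow (n + 1) y
  rcases eq_or_ne x 0 with rfl | hx
  · exact hasDerivAt_of_hasDerivAt_of_ne (g := fun x => (n + 1 : ℝ) * (max x 0) ^ n) hne
      (by fun_prop) (by fun_prop)
  · exact hne x hx

lemma hasDerivAt_max_zero_pow_affine {n : ℕ} (hn : 1 ≤ n) (a b x : ℝ) :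
    HasDerivAt (fun u : ℝ => (max (a - b * u) 0) ^ (n + 1))
      (-((n + 1 : ℝ) * b * (max (a - b * x) 0) ^ n)) x := by
  have h := (hasDerivAt_max_zero_pow hn (a - b * x)).comp x
    (((hasDerivAt_id x).const_mul b).const_sub a)
  refine h.congr_deriv ?_
  ring

lemma integral_max_zero_pow_affine {n : ℕ} (hn : 1 ≤ n) (a m : ℝ) {b : ℝ} (hb : b ≠ 0) :
    ∫ u in (0 : ℝ)..m, (max (a - b * u) 0) ^ n =
      ((max a 0) ^ (n + 1) - (max (a - b * m) 0) ^ (n + 1)) / ((n + 1) * b) := by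
  have hn' : (n + 1 : ℝ) ≠ 0 := by positivity
  have h : ∀ x ∈ Set.uIcc 0 m,
      HasDerivAt (fun u : ℝ => -((max (a - b * u) 0) ^ (n + 1)) / ((n + 1) * b))
        ((max (a - b * x) 0) ^ n) x := fun x _ => by
    refine (((hasDerivAt_max_zero_pow_affine hn a b x).neg).div_const _).congr_deriv ?_
    field_simp
  rw [intervalIntegral.integral_eq_sub_of_hasDerivAt h
    (Continuous.intervalIntegrable (by fun_prop) _ _)]
  simp only [mul_zero, sub_zero]
  ring

/-- The part of the positive orthant cut out by an upper bound `t` on the sum of the coordinates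
and an upper bound `s` on a linear form. -/
def slab {n : ℕ} (c : Fin n → ℝ) (t s : ℝ) : Set (Fin n → ℝ) :=
  {z | (∀ i, 0 ≤ z i) ∧ ∑ i, z i ≤ t ∧ ∑ i, c i * z i ≤ s}

/-- The coefficients of the volume of a slab. -/
noncomputable def slabWeight {n : ℕ} (c : Fin n → ℝ) (l : Fin n) : ℝ :=
  if c l = 0 then 0 else ∏ j, if j = l then 1 else c l / (c l - c j)

/-- The closed form of the volume of a slab. -/
noncomputable def slabVol {n : ℕ} (c : Fin n → ℝ) (t s : ℝ) : ℝ :=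
  (t ^ n - ∑ l, slabWeight c l * (max (t - s / c l) 0) ^ n) / n !

lemma measurableSet_slab {n : ℕ} (c : Fin n → ℝ) (t s : ℝ) : MeasurableSet (slab c t s) := by
  have h : slab c t s = (⋂ i, {z | 0 ≤ z i}) ∩
      ({z | ∑ i, z i ≤ t} ∩ {z | ∑ i, c i * z i ≤ s}) := by
    ext z; simp [slab]
  rw [h]
  exact (MeasurableSet.iInter fun i => measurableSet_le measurable_const
    (measurable_pi_apply i)).inter ((measurableSet_le (by fun_prop) measurable_const).inter
    (measurableSet_le (by fun_prop) measurable_const))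

lemma cons_mem_slab_iff {n : ℕ} (c : Fin (n + 1) → ℝ) (t s u : ℝ) (z : Fin n → ℝ) :
    Fin.cons u z ∈ slab c t s ↔ 0 ≤ u ∧ z ∈ slab (Fin.tail c) (t - u) (s - c 0 * u) := by
  simp only [slab, Set.mem_ofPred_eq, Fin.forall_fin_succ, Fin.sum_univ_succ, Fin.cons_zero,
    Fin.cons_succ, Fin.tail, le_sub_iff_add_le']
  tauto

lemma volume_eq_lintegral_cons {n : ℕ} {A : Set (Fin (n + 1) → ℝ)} (hA : MeasurableSet A) :
    volume A = ∫⁻ u : ℝ, volume {z : Fin n → ℝ | (Fin.cons u z : Fin (n + 1) → ℝ) ∈ A} := by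
  have h := (volume_preserving_piFinSuccAbove (fun _ : Fin (n + 1) => ℝ) 0).symm
  rw [← h.measure_preimage hA.nullMeasurableSet, Measure.volume_eq_prod,
    Measure.prod_apply (h.measurable hA)]
  refine lintegral_congr fun u => congrArg _ ?_
  ext z
  simp [MeasurableEquiv.piFinSuccAbove, Fin.insertNthEquiv]

lemma volume_slab_succ {n : ℕ} (c : Fin (n + 1) → ℝ) (t s : ℝ) :
    volume (slab c t s) =
      ∫⁻ u in Set.Ici 0, volume (slab (Fin.tail c) (t - u) (s - c 0 * u)) := by
  rw [volume_eq_lintegral_cons (measurableSet_slab c t s),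
    ← lintegral_indicator measurableSet_Ici]
  refine lintegral_congr fun u => ?_
  by_cases hu : 0 ≤ u
  · simp [cons_mem_slab_iff, Set.indicator, hu]
  · simp [cons_mem_slab_iff, Set.indicator, hu]

lemma slabWeight_succ {n : ℕ} (c : Fin (n + 1) → ℝ) (l : Fin n) :
    slabWeight c l.succ =
      slabWeight (Fin.tail c) l * (c l.succ / (c l.succ - c 0)) := by
  unfold slabWeight Fin.tail
  split_ifs with h
  · simp
  · rw [Fin.prod_univ_succ, mul_comm]
    simp [Fin.succ_inj, (Fin.succ_ne_zero l).symm]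

lemma sum_slabWeight {n : ℕ} {c : Fin n → ℝ} (hc : ∀ i j, i ≠ j → c i ≠ 0 → c i ≠ c j)
    (h : ∃ i, c i ≠ 0) : ∑ l, slabWeight c l = 1 := by
  classical
  set S : Finset (Fin n) := Finset.univ.filter fun i => c i ≠ 0 with hS
  have hinj : Set.InjOn (fun i => (c i)⁻¹) (S : Set (Fin n)) := by
    intro i hi j hj hij
    by_contra hne
    exact hc i j hne (by simpa [hS] using hi) (inv_injective hij)
  obtain ⟨i, hi⟩ := h
  have hb := congrArg (Polynomial.eval 0)
    (Lagrange.sum_basis hinj ⟨i, by simpa [hS] using hi⟩)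
  rw [Polynomial.eval_finsetSum, Polynomial.eval_one] at hb
  rw [← hb, ← Finset.sum_filter_add_sum_filter_not Finset.univ (fun i => c i ≠ 0)]
  rw [Finset.sum_eq_zero (s := Finset.univ.filter fun i => ¬ c i ≠ 0)
    (fun l hl => by simp at hl; simp [slabWeight, hl]), add_zero]
  refine Finset.sum_congr rfl fun l hl => ?_
  have hl0 : c l ≠ 0 := by simpa [hS] using hl
  rw [slabWeight, if_neg hl0, Lagrange.basis, Polynomial.eval_prod]
  rw [← Finset.prod_subset (Finset.subset_univ (S.erase l))]
  · refine Finset.prod_congr rfl fun j hj => ?_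
    obtain ⟨hjl, hjS⟩ := Finset.mem_erase.1 hj
    have hj0 : c j ≠ 0 := by simpa [hS] using hjS
    have hlj : c l - c j ≠ 0 := sub_ne_zero.2 (hc l j (Ne.symm hjl) hl0)
    have hjl' : c j - c l ≠ 0 := sub_ne_zero.2 (hc l j (Ne.symm hjl) hl0).symm
    have hd : (c l)⁻¹ - (c j)⁻¹ ≠ 0 := by
      rw [inv_sub_inv hl0 hj0]; exact div_ne_zero hjl' (mul_ne_zero hl0 hj0)
    rw [if_neg hjl, Lagrange.basisDivisor]
    simp only [Polynomial.eval_mul, Polynomial.eval_C, Polynomial.eval_sub, Polynomial.eval_X]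
    rw [inv_sub_inv hl0 hj0]
    field_simp
    ring
  · intro j _ hj
    by_cases hjl : j = l
    · simp [hjl]
    · have : c j = 0 := by
        by_contra h0
        exact hj (Finset.mem_erase.2 ⟨hjl, by simpa [hS] using h0⟩)
      simp [hjl, this, hl0]

lemma integral_slabVol_tail {n : ℕ} {c : Fin (n + 1) → ℝ} (hc0 : ∀ i, 0 ≤ c i)
    (hc : ∀ i j, i ≠ j → c i ≠ 0 → c i ≠ c j) {t s m : ℝ}
    (hmt : m ≤ t) (hms : c 0 * m ≤ s) (hm : m = t ∨ c 0 ≠ 0 ∧ c 0 * m = s) :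
    ∫ u in (0 : ℝ)..m, slabVol (Fin.tail c) (t - u) (s - c 0 * u) = slabVol c t s := by
  have hn' : (n + 1 : ℝ) ≠ 0 := by positivity
  have hterm : ∀ l : Fin n,
      ∫ u in (0 : ℝ)..m, slabWeight (Fin.tail c) l *
        (max (t - u - (s - c 0 * u) / Fin.tail c l) 0) ^ n =
      slabWeight c l.succ * ((max (t - s / c l.succ) 0) ^ (n + 1) - (t - m) ^ (n + 1)) /
        (n + 1) := by
    intro l
    rw [intervalIntegral.integral_const_mul, slabWeight_succ]
    by_cases hl : c l.succ = 0
    · simp [slabWeight, Fin.tail, hl]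
    have hlp : 0 < c l.succ := lt_of_le_of_ne (hc0 _) (Ne.symm hl)
    have hne : c l.succ - c 0 ≠ 0 := sub_ne_zero.2 (hc _ _ (Fin.succ_ne_zero l) hl)
    have hb : 1 - c 0 / c l.succ ≠ 0 := by
      rw [one_sub_div hl]; exact div_ne_zero hne hl
    have hfun : ∀ u, t - u - (s - c 0 * u) / Fin.tail c l =
        (t - s / c l.succ) - (1 - c 0 / c l.succ) * u := by
      intro u; simp only [Fin.tail]; field_simp; ring
    simp only [hfun]
    rw [integral_max_zero_pow_affine (Fin.pos l) _ _ hb]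
    have hend : max (t - s / c l.succ - (1 - c 0 / c l.succ) * m) 0 = t - m := by
      have hrw : t - s / c l.succ - (1 - c 0 / c l.succ) * m = t - m - (s - c 0 * m) / c l.succ := by
        field_simp; ring
      rw [hrw]
      rcases hm with rfl | ⟨-, h⟩
      · rw [max_eq_right, sub_self]
        have : 0 ≤ (s - c 0 * m) / c l.succ := div_nonneg (by linarith) hlp.le
        linarith
      · rw [h, sub_self, zero_div, sub_zero, max_eq_left (by linarith)]
    rw [hend, one_sub_div hl]
    field_simp
  have hcont : ∀ l : Fin n, IntervalIntegrable (fun u => slabWeight (Fin.tail c) l *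
        (max (t - u - (s - c 0 * u) / Fin.tail c l) 0) ^ n) volume 0 m := fun l =>
    Continuous.intervalIntegrable (by fun_prop) _ _
  have hpow : ∫ u in (0 : ℝ)..m, (t - u) ^ n = (t ^ (n + 1) - (t - m) ^ (n + 1)) / (n + 1) := by
    rw [intervalIntegral.integral_comp_sub_left (fun x => x ^ n) t, integral_pow]
    simp
  have hlast : (t - m) ^ (n + 1) * (1 - ∑ l : Fin n, slabWeight c l.succ) =
      slabWeight c 0 * (max (t - s / c 0) 0) ^ (n + 1) := by
    by_cases h0 : c 0 = 0
    · have hs : m = t := by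
        rcases hm with h | h
        · exact h
        · exact absurd h0 h.1
      simp [slabWeight, h0, hs]
    · have h0p : 0 < c 0 := lt_of_le_of_ne (hc0 _) (Ne.symm h0)
      have hsum := sum_slabWeight hc ⟨0, h0⟩
      rw [Fin.sum_univ_succ] at hsum
      have h1 : 1 - ∑ l : Fin n, slabWeight c l.succ = slabWeight c 0 := by linarith
      have h2 : max (t - s / c 0) 0 = t - m := by
        rcases hm with rfl | ⟨-, h⟩
        · rw [sub_self, max_eq_right]
          rw [sub_nonpos, le_div_iff₀ h0p]; linarith
        · rw [← h, mul_div_cancel_left₀ _ h0, max_eq_left (by linarith)]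
      rw [h1, h2, mul_comm]
  unfold slabVol
  rw [intervalIntegral.integral_div, intervalIntegral.integral_sub
    (Continuous.intervalIntegrable (by fun_prop) _ _)
    (Continuous.intervalIntegrable (by fun_prop) _ _),
    intervalIntegral.integral_finsetSum (fun l _ => hcont l), hpow,
    Finset.sum_congr rfl (fun l _ => hterm l), Fin.sum_univ_succ, ← hlast,
    ← Finset.sum_div, Nat.factorial_succ]
  simp only [mul_sub, Finset.sum_sub_distrib, ← Finset.sum_mul]
  push_cast
  field_simp
  ring

theorem volume_slab {n : ℕ} {c : Fin n → ℝ} (hc0 : ∀ i, 0 ≤ c i)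
    (hc : ∀ i j, i ≠ j → c i ≠ 0 → c i ≠ c j) {t s : ℝ} (ht : 0 ≤ t) (hs : 0 ≤ s) :
    0 ≤ slabVol c t s ∧ volume (slab c t s) = ENNReal.ofReal (slabVol c t s) := by
  induction n generalizing t s with
  | zero =>
    have : slab c t s = Set.univ := by
      ext z; simp [slab, ht, hs]
    simp [slabVol, this, volume_pi]
  | succ n ih =>
    have hc0' : ∀ i, 0 ≤ Fin.tail c i := fun i => hc0 _
    have hc' : ∀ i j, i ≠ j → Fin.tail c i ≠ 0 → Fin.tail c i ≠ Fin.tail c j := fun i j hij =>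
      hc _ _ (fun h => hij (Fin.succ_injective _ h))
    obtain ⟨m, hm0, hmt, hms, hm, hmax⟩ : ∃ m, 0 ≤ m ∧ m ≤ t ∧ c 0 * m ≤ s ∧
        (m = t ∨ c 0 ≠ 0 ∧ c 0 * m = s) ∧ ∀ u, u ≤ t → c 0 * u ≤ s → u ≤ m := by
      rcases le_or_gt (c 0 * t) s with h | h
      · exact ⟨t, ht, le_rfl, h, Or.inl rfl, fun u hu _ => hu⟩
      · have h0 : c 0 ≠ 0 := by
          intro h0; rw [h0, zero_mul] at h; linarith
        have h0p : 0 < c 0 := lt_of_le_of_ne (hc0 _) (Ne.symm h0)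
        have he : c 0 * (s / c 0) = s := mul_div_cancel₀ _ h0
        refine ⟨s / c 0, by positivity, ?_, he.le, Or.inr ⟨h0, he⟩, fun u _ hu => ?_⟩
        · rw [div_le_iff₀ h0p]; linarith
        · rw [le_div_iff₀ h0p]; linarith
    have hpos : ∀ u ∈ Set.Icc 0 m, 0 ≤ slabVol (Fin.tail c) (t - u) (s - c 0 * u) ∧
        volume (slab (Fin.tail c) (t - u) (s - c 0 * u)) =
          ENNReal.ofReal (slabVol (Fin.tail c) (t - u) (s - c 0 * u)) := by
      intro u hu
      refine ih hc0' hc' (by linarith [hu.2]) ?_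
      have := mul_le_mul_of_nonneg_left hu.2 (hc0 0)
      linarith
    have hint := integral_slabVol_tail hc0 hc hmt hms hm
    have hcont : Continuous fun u => slabVol (Fin.tail c) (t - u) (s - c 0 * u) := by
      unfold slabVol; fun_prop
    refine ⟨?_, ?_⟩
    · rw [← hint]
      exact intervalIntegral.integral_nonneg hm0 fun u hu => (hpos u hu).1
    · rw [volume_slab_succ, ← hint, intervalIntegral.integral_of_le hm0,
        ← integral_Icc_eq_integral_Ioc,
        ofReal_integral_eq_lintegral_ofReal hcont.integrableOn_Icc
          ((ae_restrict_iff' measurableSet_Icc).2 (Filter.Eventually.of_forall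
            fun u hu => (hpos u hu).1)),
        ← lintegral_indicator measurableSet_Ici, ← lintegral_indicator measurableSet_Icc]
      refine lintegral_congr fun u => ?_
      by_cases hu : u ∈ Set.Icc 0 m
      · rw [Set.indicator_of_mem hu, Set.indicator_of_mem (Set.mem_Ici.2 hu.1), (hpos u hu).2]
      · rw [Set.indicator_of_notMem hu]
        by_cases hu0 : 0 ≤ u
        · rw [Set.indicator_of_mem (Set.mem_Ici.2 hu0)]
          have hempty : slab (Fin.tail c) (t - u) (s - c 0 * u) = ∅ := by
            refine Set.eq_empty_of_forall_notMem fun z hz => hu ⟨hu0, hmax u ?_ ?_⟩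
            · have := Finset.sum_nonneg fun i (_ : i ∈ Finset.univ) => hz.1 i
              linarith [hz.2.1]
            · have := Finset.sum_nonneg fun i (_ : i ∈ Finset.univ) =>
                mul_nonneg (hc0' i) (hz.1 i)
              linarith [hz.2.2]
          rw [hempty, measure_empty]
        · rw [Set.indicator_of_notMem (by simpa using hu0)]

lemma orderStat_of_monotone {n : ℕ} {x : Fin n → ℝ} (hx : Monotone x) : orderStat x = x := by
  rw [orderStat, Tuple.sort_eq_refl_iff_monotone.2 hx]
  rfl

lemma orderStat_comp_perm {n : ℕ} (x : Fin n → ℝ) (σ : Equiv.Perm (Fin n)) :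
    orderStat (x ∘ σ) = orderStat x :=
  Tuple.comp_perm_comp_sort_eq_comp_sort

lemma measurableSet_monotone (n : ℕ) : MeasurableSet {x : Fin n → ℝ | Monotone x} := by
  have h : {x : Fin n → ℝ | Monotone x} = ⋂ i, ⋂ j, {x | i ≤ j → x i ≤ x j} := by
    ext x; simp [Monotone]
  rw [h]
  refine MeasurableSet.iInter fun i => MeasurableSet.iInter fun j => ?_
  by_cases hij : i ≤ j
  · simpa [hij] using measurableSet_le (measurable_pi_apply i) (measurable_pi_apply j)
  · simp [hij]

lemma measurable_comp_perm {n : ℕ} (σ : Equiv.Perm (Fin n)) :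
    Measurable fun x : Fin n → ℝ => x ∘ σ :=
  measurable_pi_lambda _ fun i => measurable_pi_apply (σ i)

lemma measurable_orderStat (n : ℕ) : Measurable (orderStat : (Fin n → ℝ) → Fin n → ℝ) := by
  intro S hS
  have h : orderStat ⁻¹' S = ⋃ σ : Equiv.Perm (Fin n),
      (fun x : Fin n → ℝ => x ∘ σ) ⁻¹' ({x | Monotone x} ∩ S) := by
    ext x
    simp only [Set.mem_preimage, Set.mem_iUnion, Set.mem_inter_iff, Set.mem_ofPred_eq]
    constructor
    · intro hx
      exact ⟨Tuple.sort x, Tuple.monotone_sort x, hx⟩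
    · rintro ⟨σ, hm, hx⟩
      rwa [← orderStat_comp_perm x σ, orderStat_of_monotone hm]
  rw [h]
  exact MeasurableSet.iUnion fun σ => measurable_comp_perm σ ((measurableSet_monotone n).inter hS)

lemma measurable_innerSpacing (N : ℕ) :
    Measurable (innerSpacing : (Fin N → ℝ) → Fin (N - 1) → ℝ) :=
  measurable_pi_lambda _ fun _ =>
    ((measurable_pi_apply _).comp (measurable_orderStat N)).sub
      ((measurable_pi_apply _).comp (measurable_orderStat N))

lemma measurable_sumSmallest (n k : ℕ) :
    Measurable (sumSmallest k : (Fin n → ℝ) → ℝ) :=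
  Finset.measurable_fun_sum _ fun j _ => (measurable_pi_apply j).comp (measurable_orderStat n)

lemma innerSpacing_comp_perm {N : ℕ} (x : Fin N → ℝ) (σ : Equiv.Perm (Fin N)) :
    innerSpacing (x ∘ σ) = innerSpacing x := by
  funext j
  rw [innerSpacing, innerSpacing, orderStat_comp_perm]

lemma sumSmallest_comp_perm {n : ℕ} (k : ℕ) (x : Fin n → ℝ) (σ : Equiv.Perm (Fin n)) :
    sumSmallest k (x ∘ σ) = sumSmallest k x := by
  rw [sumSmallest, sumSmallest, orderStat_comp_perm]

lemma volume_not_injective (n : ℕ) :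
    volume {x : Fin n → ℝ | ¬ Function.Injective x} = 0 := by
  let H : Fin n × Fin n → Submodule ℝ (Fin n → ℝ) := fun p =>
    LinearMap.ker ((LinearMap.proj p.1 : (Fin n → ℝ) →ₗ[ℝ] ℝ) - LinearMap.proj p.2)
  have h : {x : Fin n → ℝ | ¬ Function.Injective x} ⊆
      ⋃ p : {p : Fin n × Fin n // p.1 ≠ p.2}, (H p : Set (Fin n → ℝ)) := by
    intro x hx
    simp only [Function.Injective, Set.mem_ofPred_eq, not_forall] at hx
    obtain ⟨i, j, hij, hne⟩ := hx
    refine Set.mem_iUnion.2 ⟨⟨(i, j), hne⟩, ?_⟩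
    simp [H, hij]
  refine measure_mono_null h (measure_iUnion_null fun p => ?_)
  refine Measure.addHaar_submodule _ _ fun htop => ?_
  have hmem : (Pi.single p.1.1 1 : Fin n → ℝ) ∈ H p := by
    rw [htop]; trivial
  simp [H, p.2.symm] at hmem

lemma measurePreserving_comp_perm {n : ℕ} (σ : Equiv.Perm (Fin n)) :
    MeasurePreserving (fun x : Fin n → ℝ => x ∘ σ) volume volume := by
  convert volume_measurePreserving_piCongrLeft (fun _ : Fin n => ℝ) σ.symm using 1
  funext x i
  have := MeasurableEquiv.piCongrLeft_apply_apply (β := fun _ : Fin n => ℝ) σ.symm x (σ i)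
  simpa using this.symm

theorem volume_eq_factorial_mul_volume_monotone {n : ℕ} {A : Set (Fin n → ℝ)}
    (hA : MeasurableSet A)
    (hperm : ∀ (σ : Equiv.Perm (Fin n)) (x : Fin n → ℝ), x ∘ σ ∈ A ↔ x ∈ A) :
    volume A = n ! * volume (A ∩ {x | Monotone x}) := by
  set B : Set (Fin n → ℝ) := A ∩ {x | Monotone x} ∩ {x | Function.Injective x} with hB
  have hae : ∀ᵐ x : Fin n → ℝ, Function.Injective x := volume_not_injective n
  have hcongr : ∀ S : Set (Fin n → ℝ), volume (S ∩ {x | Function.Injective x}) = volume S :=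
    fun S => measure_congr (by
      filter_upwards [hae] with x hx
      exact propext ⟨fun h => h.1, fun h => ⟨h, hx⟩⟩)
  have hBnull : NullMeasurableSet B volume :=
    (hA.inter (measurableSet_monotone n)).nullMeasurableSet.inter
      (NullMeasurableSet.of_compl (NullMeasurableSet.of_null (volume_not_injective n)))
  have hunion : A ∩ {x | Function.Injective x} =
      ⋃ σ : Equiv.Perm (Fin n), (fun x : Fin n → ℝ => x ∘ σ) ⁻¹' B := by
    ext x
    simp only [hB, Set.mem_iUnion, Set.mem_preimage, Set.mem_inter_iff, Set.mem_ofPred_eq,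
      Equiv.injective_comp, hperm]
    constructor
    · rintro ⟨h1, h2⟩
      exact ⟨Tuple.sort x, ⟨h1, Tuple.monotone_sort x⟩, h2⟩
    · rintro ⟨σ, ⟨h1, -⟩, h2⟩
      exact ⟨h1, h2⟩
  have hdisj : Pairwise (Function.onFun (AEDisjoint volume)
      fun σ : Equiv.Perm (Fin n) => (fun x : Fin n → ℝ => x ∘ σ) ⁻¹' B) := by
    intro σ τ hne
    refine Disjoint.aedisjoint (Set.disjoint_left.2 fun x hx hy => hne ?_)
    simp only [hB, Set.mem_preimage, Set.mem_inter_iff, Set.mem_ofPred_eq,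
      Equiv.injective_comp] at hx hy
    have := Tuple.unique_monotone hx.1.2 hy.1.2
    exact Equiv.ext fun i => hx.2 (congrFun this i)
  rw [← hcongr A, hunion, measure_iUnion₀ hdisj fun σ =>
      hBnull.preimage (measurePreserving_comp_perm σ).quasiMeasurePreserving]
  simp_rw [fun σ => (measurePreserving_comp_perm σ).measure_preimage hBnull]
  rw [ENNReal.tsum_const, hB, hcongr]
  simp [Fintype.card_perm, ENat.card_eq_coe_fintype_card]

/-- Weighted partial sums: the `i`-th coordinate of the image of `y` is `∑ j ≤ i, d j * y j`. -/
noncomputable def cumSum {n : ℕ} (d : Fin n → ℝ) : (Fin n → ℝ) →ₗ[ℝ] (Fin n → ℝ) :=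
  Matrix.toLin' (Matrix.of fun i j => if j ≤ i then d j else 0)

lemma cumSum_apply {n : ℕ} (d y : Fin n → ℝ) (i : Fin n) :
    cumSum d y i = ∑ j, if j ≤ i then d j * y j else 0 := by
  simp [cumSum, Matrix.mulVec, dotProduct, ite_mul]

lemma det_cumSum {n : ℕ} (d : Fin n → ℝ) : LinearMap.det (cumSum d) = ∏ j, d j := by
  rw [cumSum, LinearMap.det_toLin', Matrix.det_of_isLowerTriangular]
  · simp
  · intro i j hij
    have : i < j := hij
    simp [not_le.2 this]

lemma volume_eq_prod_mul_preimage_cumSum {n : ℕ} {d : Fin n → ℝ} (hd : ∀ j, 0 < d j)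
    (A : Set (Fin n → ℝ)) :
    volume A = ENNReal.ofReal (∏ j, d j) * volume (cumSum d ⁻¹' A) := by
  have hp : 0 < ∏ j, d j := Finset.prod_pos fun j _ => hd j
  rw [Measure.addHaar_preimage_linearMap volume (by rw [det_cumSum]; exact hp.ne'), det_cumSum,
    ← mul_assoc, ← ENNReal.ofReal_mul hp.le, abs_of_pos (inv_pos.2 hp), mul_inv_cancel₀ hp.ne',
    ENNReal.ofReal_one, one_mul]

lemma cumSum_zero {n : ℕ} (d y : Fin (n + 1) → ℝ) : cumSum d y 0 = d 0 * y 0 := by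
  simp [cumSum_apply]

lemma cumSum_last {n : ℕ} (d y : Fin (n + 1) → ℝ) :
    cumSum d y (Fin.last n) = ∑ j, d j * y j := by
  simp [cumSum_apply, Fin.le_last]

lemma cumSum_succ {n : ℕ} (d y : Fin (n + 1) → ℝ) (j : Fin n) :
    cumSum d y j.succ = cumSum d y j.castSucc + d j.succ * y j.succ := by
  have h : d j.succ * y j.succ = ∑ i, if i = j.succ then d i * y i else 0 := by simp
  rw [cumSum_apply, cumSum_apply, h, ← Finset.sum_add_distrib]
  refine Finset.sum_congr rfl fun i _ => ?_
  rcases lt_trichotomy i j.succ with hi | rfl | hi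
  · simp [hi.le, hi.ne, Fin.le_castSucc_iff.2 hi]
  · simp
  · simp [not_le.2 hi, hi.ne', (Fin.le_castSucc_iff (i := i) (j := j)).not.2 hi.not_gt]

lemma monotone_cumSum_iff {n : ℕ} {d : Fin (n + 1) → ℝ} (hd : ∀ j, 0 < d j)
    (y : Fin (n + 1) → ℝ) : Monotone (cumSum d y) ↔ ∀ j : Fin n, 0 ≤ y j.succ := by
  rw [Fin.monotone_iff_le_succ]
  refine forall_congr' fun j => ?_
  rw [cumSum_succ, le_add_iff_nonneg_right, mul_nonneg_iff_of_pos_left (hd _)]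

lemma nonneg_monotone_cumSum_iff {n : ℕ} {d : Fin (n + 1) → ℝ} (hd : ∀ j, 0 < d j)
    (y : Fin (n + 1) → ℝ) :
    (∀ i, 0 ≤ cumSum d y i) ∧ Monotone (cumSum d y) ↔ ∀ i, 0 ≤ y i := by
  rw [Fin.forall_fin_succ (P := fun i => 0 ≤ y i), ← monotone_cumSum_iff hd,
    ← mul_nonneg_iff_of_pos_left (hd 0), ← cumSum_zero d y]
  exact ⟨fun h => ⟨h.1 0, h.2⟩, fun h => ⟨fun i => h.1.trans (h.2 (Fin.zero_le i)), h.2⟩⟩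

lemma sum_cumSum {n : ℕ} (d y : Fin n → ℝ) (S : Finset (Fin n)) :
    ∑ j ∈ S, cumSum d y j = ∑ l, ((S.filter fun j => l ≤ j).card : ℝ) * (d l * y l) := by
  simp only [cumSum_apply]
  rw [Finset.sum_comm]
  refine Finset.sum_congr rfl fun l _ => ?_
  rw [← Finset.sum_filter, Finset.sum_const, nsmul_eq_mul]

lemma card_filter_lt_filter_le {n k : ℕ} (hk : k ≤ n) (l : Fin n) :
    ((Finset.univ.filter fun j : Fin n => j.val < k).filter fun j => l ≤ j).card = k - l := by
  rw [Finset.filter_filter, ← Nat.card_Ico, ← Finset.card_map Fin.valEmbedding]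
  congr 1
  ext a
  simp only [Finset.mem_map, Finset.mem_filter, Finset.mem_univ, true_and, Finset.mem_Ico,
    Fin.valEmbedding_apply, Fin.le_def]
  constructor
  · rintro ⟨j, ⟨h1, h2⟩, rfl⟩
    exact ⟨h2, h1⟩
  · rintro ⟨h1, h2⟩
    exact ⟨⟨a, by omega⟩, ⟨h2, h1⟩, rfl⟩

/-- The coefficients of the sum of the `k` smallest of `M` numbers with respect to the
normalized increments of their order statistics. -/
noncomputable def gapCoeff (M k : ℕ) (l : Fin M) : ℝ :=
  ((k - l.val : ℕ) : ℝ) / ((M : ℝ) - l.val)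

theorem volume_sumSmallest_le {M k : ℕ} (hM : 0 < M) (hk : k ≤ M) (t s : ℝ) :
    volume {g : Fin M → ℝ | (∀ i, 0 ≤ g i) ∧ ∑ i, g i ≤ t ∧ sumSmallest k g ≤ s} =
      volume (slab (gapCoeff M k) t s) := by
  obtain ⟨m, rfl⟩ : ∃ m, M = m + 1 := ⟨M - 1, by omega⟩
  set A : Set (Fin (m + 1) → ℝ) :=
    {g | (∀ i, 0 ≤ g i) ∧ ∑ i, g i ≤ t ∧ sumSmallest k g ≤ s} with hA
  have hmeas : MeasurableSet A := by
    have h : A = (⋂ i, {z | 0 ≤ z i}) ∩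
        ({z | ∑ i, z i ≤ t} ∩ {z | sumSmallest k z ≤ s}) := by
      ext z; simp [hA]
    rw [h]
    exact (MeasurableSet.iInter fun i => measurableSet_le measurable_const
      (measurable_pi_apply i)).inter ((measurableSet_le (by fun_prop) measurable_const).inter
      (measurableSet_le (measurable_sumSmallest _ _) measurable_const))
  have hperm : ∀ (σ : Equiv.Perm (Fin (m + 1))) (x : Fin (m + 1) → ℝ), x ∘ σ ∈ A ↔ x ∈ A := by
    intro σ x
    simp only [hA, Set.mem_ofPred_eq, sumSmallest_comp_perm, Function.comp_apply,
      Equiv.sum_comp σ x]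
    rw [σ.forall_congr_left (p := fun i => 0 ≤ x (σ i))]
    simp
  let d : Fin (m + 1) → ℝ := fun l => (((m + 1 : ℕ) : ℝ) - l.val)⁻¹
  have hd : ∀ l, 0 < d l := fun l => inv_pos.2 (sub_pos.2 (by exact_mod_cast l.2))
  have hprod : ∏ l, d l = (((m + 1)! : ℕ) : ℝ)⁻¹ := by
    rw [Finset.prod_inv_distrib, ← Finset.prod_range_add_one_eq_factorial,
      ← Finset.prod_range_reflect, ← Fin.prod_univ_eq_prod_range
      (fun j => m + 1 - 1 - j + 1)]
    push_cast
    congr 1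
    refine Finset.prod_congr rfl fun l _ => ?_
    have : l.val ≤ m := Nat.lt_succ_iff.1 l.2
    rw [Nat.cast_sub this]
    ring
  have hpre : cumSum d ⁻¹' (A ∩ {x | Monotone x}) = slab (gapCoeff (m + 1) k) t s := by
    ext z
    have hiff := nonneg_monotone_cumSum_iff hd z
    have hsum : ∑ i, cumSum d z i = ∑ i, z i := by
      rw [sum_cumSum]
      refine Finset.sum_congr rfl fun l _ => ?_
      have hc := card_filter_lt_filter_le (le_refl (m + 1)) l
      rw [Finset.filter_true_of_mem (s := Finset.univ) (fun j _ => j.2)] at hc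
      rw [hc, ← mul_assoc, Nat.cast_sub l.2.le, mul_inv_cancel₀ (inv_pos.1 (hd l)).ne', one_mul]
    have hsmall : Monotone (cumSum d z) →
        sumSmallest k (cumSum d z) = ∑ l, gapCoeff (m + 1) k l * z l := by
      intro hmono
      rw [sumSmallest, orderStat_of_monotone hmono, sum_cumSum]
      refine Finset.sum_congr rfl fun l _ => ?_
      rw [card_filter_lt_filter_le hk, gapCoeff, div_eq_mul_inv, mul_assoc]
    simp only [hA, slab, Set.mem_preimage, Set.mem_inter_iff, Set.mem_ofPred_eq]
    rw [← hiff, hsum]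
    constructor
    · rintro ⟨⟨h1, h2, h3⟩, h4⟩
      exact ⟨⟨h1, h4⟩, h2, hsmall h4 ▸ h3⟩
    · rintro ⟨⟨h1, h4⟩, h2, h3⟩
      exact ⟨⟨h1, h2, (hsmall h4).symm ▸ h3⟩, h4⟩
  have hfac : (((m + 1)! : ℕ) : ENNReal) * ENNReal.ofReal ((((m + 1)! : ℕ) : ℝ)⁻¹) = 1 := by
    have hpos : (0 : ℝ) < (((m + 1)! : ℕ) : ℝ) := by exact_mod_cast Nat.factorial_pos _
    rw [← ENNReal.ofReal_natCast, ← ENNReal.ofReal_mul hpos.le, mul_inv_cancel₀ hpos.ne',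
      ENNReal.ofReal_one]
  rw [volume_eq_factorial_mul_volume_monotone hmeas hperm,
    volume_eq_prod_mul_preimage_cumSum hd, hpre, hprod, ← mul_assoc, hfac, one_mul]

theorem volume_sumSmallest_innerSpacing_le {M k : ℕ} (hM : 0 < M) (hk : k ≤ M) (s : ℝ) :
    volume {x : Fin (M + 1) → ℝ | (∀ i, x i ∈ Set.Icc (0 : ℝ) 1) ∧
        sumSmallest k (innerSpacing x) ≤ s} =
      (M + 1)! * volume (slab (Fin.cons 0 (gapCoeff M k) : Fin (M + 1) → ℝ) 1 s) := by
  set A : Set (Fin (M + 1) → ℝ) := {x | (∀ i, x i ∈ Set.Icc (0 : ℝ) 1) ∧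
        sumSmallest k (innerSpacing x) ≤ s} with hA
  have hmeas : MeasurableSet A := by
    have h : A = (⋂ i, {x | x i ∈ Set.Icc (0 : ℝ) 1}) ∩
        {x | sumSmallest k (innerSpacing x) ≤ s} := by
      ext z; simp [hA]
    rw [h]
    exact (MeasurableSet.iInter fun i => measurable_pi_apply i measurableSet_Icc).inter
      (measurableSet_le ((measurable_sumSmallest _ _).comp (measurable_innerSpacing _))
        measurable_const)
  have hperm : ∀ (σ : Equiv.Perm (Fin (M + 1))) (x : Fin (M + 1) → ℝ), x ∘ σ ∈ A ↔ x ∈ A := by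
    intro σ x
    simp only [hA, Set.mem_ofPred_eq, innerSpacing_comp_perm, Function.comp_apply]
    rw [σ.forall_congr_left (p := fun i => x (σ i) ∈ Set.Icc (0 : ℝ) 1)]
    simp
  set B : Set (Fin (M + 1) → ℝ) := {y | (∀ i, 0 ≤ y i) ∧ ∑ i, y i ≤ 1 ∧
    sumSmallest k (Fin.tail y) ≤ s} with hB
  have hBmeas : MeasurableSet B := by
    have h : B = (⋂ i, {z | 0 ≤ z i}) ∩
        ({z | ∑ i, z i ≤ 1} ∩ {z | sumSmallest k (Fin.tail z) ≤ s}) := by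
      ext z; simp [hB]
    rw [h]
    exact (MeasurableSet.iInter fun i => measurableSet_le measurable_const
      (measurable_pi_apply i)).inter ((measurableSet_le (by fun_prop) measurable_const).inter
      (measurableSet_le ((measurable_sumSmallest _ _).comp
        (measurable_pi_lambda _ fun i => measurable_pi_apply i.succ)) measurable_const))
  have hone : ∀ j : Fin (M + 1), (0 : ℝ) < (fun _ => 1 : Fin (M + 1) → ℝ) j := fun _ => one_pos
  have hpre : cumSum (fun _ => 1) ⁻¹' (A ∩ {x | Monotone x}) = B := by
    ext y
    have hiff := nonneg_monotone_cumSum_iff hone y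
    have hlast := cumSum_last (fun _ => 1) y
    simp only [one_mul] at hlast
    have hgap : Monotone (cumSum (fun _ => 1) y) →
        innerSpacing (cumSum (fun _ => 1) y) = Fin.tail y := by
      intro hmono
      funext j
      rw [innerSpacing, orderStat_of_monotone hmono]
      have := cumSum_succ (fun _ => 1) y j
      rw [one_mul] at this
      exact sub_eq_of_eq_add' this
    simp only [hA, hB, Set.mem_preimage, Set.mem_inter_iff, Set.mem_ofPred_eq, Set.mem_Icc]
    rw [← hiff, ← hlast]
    constructor
    · rintro ⟨⟨h1, h3⟩, h4⟩
      exact ⟨⟨fun i => (h1 i).1, h4⟩, (h1 _).2, hgap h4 ▸ h3⟩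
    · rintro ⟨⟨h1, h4⟩, h2, h3⟩
      exact ⟨⟨fun i => ⟨h1 i, (h4 (Fin.le_last i)).trans h2⟩, (hgap h4).symm ▸ h3⟩, h4⟩
  have hBvol : volume B = volume (slab (Fin.cons 0 (gapCoeff M k) : Fin (M + 1) → ℝ) 1 s) := by
    rw [volume_eq_lintegral_cons hBmeas, volume_slab_succ, ← lintegral_indicator measurableSet_Ici]
    refine lintegral_congr fun u => ?_
    have hcons : {z : Fin M → ℝ | (Fin.cons u z : Fin (M + 1) → ℝ) ∈ B} = {z | 0 ≤ u ∧
        ((∀ i, 0 ≤ z i) ∧ ∑ i, z i ≤ 1 - u ∧ sumSmallest k z ≤ s)} := by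
      ext z
      simp only [hB, Set.mem_ofPred_eq, Fin.forall_fin_succ, Fin.sum_univ_succ, Fin.cons_zero,
        Fin.cons_succ, Fin.tail_cons, le_sub_iff_add_le']
      tauto
    rw [hcons]
    by_cases hu : 0 ≤ u
    · simp only [hu, true_and]
      rw [volume_sumSmallest_le hM hk, Set.indicator_of_mem (Set.mem_Ici.2 hu), Fin.tail_cons,
        Fin.cons_zero, zero_mul, sub_zero]
    · simp [hu]
  rw [volume_eq_factorial_mul_volume_monotone hmeas hperm,
    volume_eq_prod_mul_preimage_cumSum hone, hpre, hBvol]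
  simp

@[to_additive]
lemma prod_univ_fin_eq_prod_of_subset {R : Type*} [CommMonoid R] {n : ℕ} {f : Fin n → R}
    {F : ℕ → R} {S : Finset ℕ} (hS : ∀ i ∈ S, i < n) (h1 : ∀ l : Fin n, l.val ∈ S → f l = F l)
    (h2 : ∀ l : Fin n, l.val ∉ S → f l = 1) : ∏ l, f l = ∏ i ∈ S, F i := by
  classical
  rw [← Finset.prod_subset (Finset.subset_univ (Finset.univ.filter fun l : Fin n => l.val ∈ S))
    (fun l _ hl => h2 l (by simpa using hl))]
  refine Finset.prod_bij (fun l _ => l.val) (fun l hl => by simpa using hl)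
    (fun a _ b _ h => Fin.ext h) (fun i hi => ⟨⟨i, hS i hi⟩, by simpa using hi, rfl⟩)
    (fun l hl => h1 l (by simpa using hl))

lemma prod_Icc_erase_sub {i k : ℕ} (hi : 1 ≤ i) (hik : i ≤ k) :
    ∏ j ∈ (Finset.Icc 1 k).erase i, ((j : ℝ) - i) =
      (-1 : ℝ) ^ (i - 1) * ((i - 1)! : ℝ) * ((k - i)! : ℝ) := by
  induction k, hik using Nat.le_induction with
  | base =>
    obtain ⟨p, rfl⟩ : ∃ p, i = p + 1 := ⟨i - 1, by omega⟩
    have h : (Finset.Icc 1 (p + 1)).erase (p + 1) = Finset.Ico 1 (p + 1) := by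
      ext a; simp only [Finset.mem_erase, Finset.mem_Icc, Finset.mem_Ico]; omega
    rw [h, Finset.prod_Ico_eq_prod_range, ← Finset.prod_range_reflect]
    simp only [Nat.add_sub_cancel, Nat.sub_self, Nat.factorial_zero, Nat.cast_one, mul_one]
    rw [← Finset.prod_range_add_one_eq_factorial, Nat.cast_prod, ← Finset.card_range p,
      ← Finset.prod_const, Finset.card_range, ← Finset.prod_mul_distrib]
    refine Finset.prod_congr rfl fun j hj => ?_
    have hj' : j < p := Finset.mem_range.1 hj
    rw [show 1 + (p - 1 - j) = p - j by omega, Nat.cast_sub hj'.le]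
    push_cast
    ring
  | succ k hik ih =>
    have h : (Finset.Icc 1 (k + 1)).erase i = insert (k + 1) ((Finset.Icc 1 k).erase i) := by
      ext a; simp only [Finset.mem_erase, Finset.mem_Icc, Finset.mem_insert]; omega
    rw [h, Finset.prod_insert (by simp), ih, Nat.succ_sub hik, Nat.factorial_succ]
    push_cast [Nat.cast_sub hik]
    ring

lemma prod_Icc_sub_mul_factorial {q k : ℕ} (hk : k ≤ q + 1) :
    (∏ j ∈ Finset.Icc 1 k, (((q + 2 : ℕ) : ℝ) - j)) * ((q + 1 - k)! : ℝ) = ((q + 1)! : ℝ) := by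
  induction k with
  | zero => simp
  | succ k ih =>
    rw [← ih (by omega), Finset.prod_Icc_succ_top (by omega), show q + 1 - k = (q + 1 - (k + 1)) + 1
      by omega, Nat.factorial_succ]
    have hc : ((q + 1 - (k + 1) + 1 : ℕ) : ℝ) = ((q + 2 : ℕ) : ℝ) - ((k + 1 : ℕ) : ℝ) := by
      rw [Nat.cast_succ, Nat.cast_sub hk]; push_cast; ring
    rw [Nat.cast_mul, hc]
    ring

/-- The ratios `(k+1-i)/(N-i)` at which the pieces of the density are cut off. -/
noncomputable def cutoff (N k i : ℕ) : ℝ := ((k : ℝ) + 1 - i) / ((N : ℝ) - i)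

/-- The coefficients of the distribution function. -/
noncomputable def cdfCoeff (N k i : ℕ) : ℝ :=
  coeffA k (N - 2) / ((N : ℝ) - 2) * (coeffa i k * ((k : ℝ) + 1 - i) / ((N : ℝ) - i))

lemma cutoff_pos {q k i : ℕ} (hk : k ≤ q) (hi : i ∈ Finset.Icc 1 k) : 0 < cutoff (q + 2) k i := by
  have h := (Finset.mem_Icc.1 hi).2
  have h1 : (i : ℝ) ≤ k := by exact_mod_cast h
  have h2 : (k : ℝ) ≤ q := by exact_mod_cast hk
  unfold cutoff
  push_cast
  exact div_pos (by linarith) (by linarith)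

lemma cutoff_sub_cutoff {q k i j : ℕ} (hk : k ≤ q) (hi : i ∈ Finset.Icc 1 k)
    (hj : j ∈ Finset.Icc 1 k) :
    cutoff (q + 2) k i - cutoff (q + 2) k j = ((j : ℝ) - i) * ((q : ℝ) + 1 - k) /
      ((((q + 2 : ℕ) : ℝ) - i) * (((q + 2 : ℕ) : ℝ) - j)) := by
  have h1 : (i : ℝ) ≤ k := by exact_mod_cast (Finset.mem_Icc.1 hi).2
  have h2 : (j : ℝ) ≤ k := by exact_mod_cast (Finset.mem_Icc.1 hj).2
  have h3 : (k : ℝ) ≤ q := by exact_mod_cast hk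
  unfold cutoff
  have h4 : ((q + 2 : ℕ) : ℝ) - i ≠ 0 := by push_cast; linarith
  have h5 : ((q + 2 : ℕ) : ℝ) - j ≠ 0 := by push_cast; linarith
  rw [div_sub_div _ _ h4 h5]
  congr 1
  push_cast
  ring

/-- The coefficient vector of the sum of the `k` smallest inner spacings. -/
noncomputable def spacingCoeff (q k : ℕ) : Fin (q + 2) → ℝ :=
  Fin.cons 0 (gapCoeff (q + 1) k)

lemma spacingCoeff_of_mem {q k : ℕ} (l : Fin (q + 2)) (hl : l.val ∈ Finset.Icc 1 k) :
    spacingCoeff q k l = cutoff (q + 2) k l := by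
  obtain ⟨h1, h2⟩ := Finset.mem_Icc.1 hl
  obtain ⟨j, rfl⟩ := Fin.exists_succ_eq.2 (show l ≠ 0 by rintro rfl; simp at h1)
  have h3 : j.val + 1 ≤ k := by simpa using h2
  rw [spacingCoeff, Fin.cons_succ, gapCoeff, cutoff, Nat.cast_sub (by omega), Fin.val_succ]
  push_cast
  congr 1 <;> ring

lemma spacingCoeff_of_notMem {q k : ℕ} (l : Fin (q + 2)) (hl : l.val ∉ Finset.Icc 1 k) :
    spacingCoeff q k l = 0 := by
  rw [spacingCoeff]
  induction l using Fin.cases with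
  | zero => rfl
  | succ j =>
    have h : k - j.val = 0 := by
      simp only [Finset.mem_Icc, Fin.val_succ] at hl; omega
    rw [Fin.cons_succ, gapCoeff, h, Nat.cast_zero, zero_div]

lemma spacingCoeff_ne_zero {q k : ℕ} {l : Fin (q + 2)} (h : spacingCoeff q k l ≠ 0) :
    l.val ∈ Finset.Icc 1 k := by
  by_contra hl
  exact h (spacingCoeff_of_notMem l hl)

lemma spacingCoeff_nonneg {q k : ℕ} (hk : k ≤ q) (l : Fin (q + 2)) : 0 ≤ spacingCoeff q k l := by
  by_cases hl : l.val ∈ Finset.Icc 1 k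
  · rw [spacingCoeff_of_mem l hl]
    exact (cutoff_pos hk hl).le
  · rw [spacingCoeff_of_notMem l hl]

lemma spacingCoeff_injective {q k : ℕ} (hk : k ≤ q) (i j : Fin (q + 2)) (hij : i ≠ j)
    (hi0 : spacingCoeff q k i ≠ 0) : spacingCoeff q k i ≠ spacingCoeff q k j := by
  intro h
  have hi := spacingCoeff_ne_zero hi0
  have hj := spacingCoeff_ne_zero (h ▸ hi0)
  rw [← sub_eq_zero, spacingCoeff_of_mem i hi, spacingCoeff_of_mem j hj,
    cutoff_sub_cutoff hk hi hj] at h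
  have h1 : (i.val : ℝ) ≤ k := by exact_mod_cast (Finset.mem_Icc.1 hi).2
  have h2 : (j.val : ℝ) ≤ k := by exact_mod_cast (Finset.mem_Icc.1 hj).2
  have h3 : (k : ℝ) ≤ q := by exact_mod_cast hk
  have h4 : ((q + 2 : ℕ) : ℝ) - i.val ≠ 0 := by push_cast; linarith
  have h5 : ((q + 2 : ℕ) : ℝ) - j.val ≠ 0 := by push_cast; linarith
  have h6 : (q : ℝ) + 1 - k ≠ 0 := by linarith
  rcases div_eq_zero_iff.1 h with h | h
  · rcases mul_eq_zero.1 h with h | h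
    · exact hij (Fin.ext (by exact_mod_cast (sub_eq_zero.1 h).symm))
    · exact h6 h
  · exact mul_ne_zero h4 h5 h

lemma prod_cutoff_div {q k i : ℕ} (hk : k ≤ q) (hi : i ∈ Finset.Icc 1 k) :
    ∏ j ∈ (Finset.Icc 1 k).erase i,
      cutoff (q + 2) k i / (cutoff (q + 2) k i - cutoff (q + 2) k j) =
      cdfCoeff (q + 2) k i := by
  obtain ⟨hi1, hik⟩ := Finset.mem_Icc.1 hi
  have h1 : (i : ℝ) ≤ k := by exact_mod_cast hik
  have h3 : (k : ℝ) ≤ q := by exact_mod_cast hk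
  have hq : (0 : ℝ) < q := by exact_mod_cast (show 0 < q by omega)
  have h4 : ((q + 2 : ℕ) : ℝ) - i ≠ 0 := by push_cast; linarith
  have hb : (k : ℝ) + 1 - i ≠ 0 := by linarith
  have h6 : (q : ℝ) + 1 - k ≠ 0 := by linarith
  have hcongr : ∀ j ∈ (Finset.Icc 1 k).erase i,
      cutoff (q + 2) k i / (cutoff (q + 2) k i - cutoff (q + 2) k j) =
      (((k : ℝ) + 1 - i) * (((q + 2 : ℕ) : ℝ) - j)) / (((j : ℝ) - i) * ((q : ℝ) + 1 - k)) := by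
    intro j hj
    obtain ⟨hji, hjk⟩ := Finset.mem_erase.1 hj
    have h2 : (j : ℝ) ≤ k := by exact_mod_cast (Finset.mem_Icc.1 hjk).2
    have h5 : ((q + 2 : ℕ) : ℝ) - j ≠ 0 := by push_cast; linarith
    have h7 : (j : ℝ) - i ≠ 0 := sub_ne_zero.2 (by exact_mod_cast hji)
    rw [cutoff_sub_cutoff hk hi hjk, cutoff]
    field_simp
  have hcard : ((Finset.Icc 1 k).erase i).card = k - 1 := by
    rw [Finset.card_erase_of_mem hi, Nat.card_Icc]; omega
  have hz : ((k : ℝ) + 1 - i) ^ ((k : ℤ) - 2) * ((k : ℝ) + 1 - i) =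
      ((k : ℝ) + 1 - i) ^ (k - 1) := by
    rw [← zpow_add_one₀ hb, ← zpow_natCast]
    congr 1
    omega
  have hfac := prod_Icc_sub_mul_factorial (q := q) (k := k) (by omega)
  rw [← Finset.mul_prod_erase _ _ hi] at hfac
  have hne : ((q + 1 - k)! : ℝ) ≠ 0 := by exact_mod_cast Nat.factorial_ne_zero _
  have hP : ∏ j ∈ (Finset.Icc 1 k).erase i, (((q + 2 : ℕ) : ℝ) - j) =
      ((q + 1)! : ℝ) / (((q + 2 : ℕ) : ℝ) - i) / ((q + 1 - k)! : ℝ) := by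
    rw [← hfac]; field_simp
  rw [Finset.prod_congr rfl hcongr, Finset.prod_div_distrib, Finset.prod_mul_distrib,
    Finset.prod_mul_distrib, Finset.prod_const, Finset.prod_const, hcard,
    prod_Icc_erase_sub hi1 hik, hP, ← hz, cdfCoeff, coeffA, coeffa]
  have hs : (((-1 : ℝ)) ^ (i - 1)) * ((-1 : ℝ)) ^ (i - 1) = 1 := by
    rw [← mul_pow]; norm_num
  have hs0 : ((-1 : ℝ)) ^ (i - 1) ≠ 0 := pow_ne_zero _ (by norm_num)
  have hf1 : ((i - 1)! : ℝ) ≠ 0 := by exact_mod_cast Nat.factorial_ne_zero _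
  have hf2 : ((k - i)! : ℝ) ≠ 0 := by exact_mod_cast Nat.factorial_ne_zero _
  have hq2 : ((q + 2 : ℕ) : ℝ) - 2 = q := by push_cast; ring
  rw [Nat.add_sub_cancel, hq2]
  generalize ((k : ℝ) + 1 - i) ^ ((k : ℤ) - 2) = Z
  generalize ((-1 : ℝ)) ^ (i - 1) = e at *
  have he : e⁻¹ = e := inv_eq_of_mul_eq_one_left hs
  rw [div_eq_mul_inv _ (e * _ * _ * _), mul_inv, mul_inv, mul_inv, he]
  field_simp

lemma slabWeight_spacingCoeff {q k : ℕ} (hk : k ≤ q) (l : Fin (q + 2))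
    (hl : l.val ∈ Finset.Icc 1 k) :
    slabWeight (spacingCoeff q k) l = cdfCoeff (q + 2) k l := by
  have h0 : spacingCoeff q k l ≠ 0 := by
    rw [spacingCoeff_of_mem l hl]; exact (cutoff_pos hk hl).ne'
  rw [slabWeight, if_neg h0, ← prod_cutoff_div hk hl]
  refine prod_univ_fin_eq_prod_of_subset ?_ ?_ ?_
  · intro i hi
    have := (Finset.mem_Icc.1 (Finset.mem_erase.1 hi).2).2
    omega
  · intro j hj
    obtain ⟨hjl, hjk⟩ := Finset.mem_erase.1 hj
    rw [if_neg (fun h => hjl (congrArg _ h)), spacingCoeff_of_mem l hl, spacingCoeff_of_mem j hjk]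
  · intro j hj
    by_cases hjl : j = l
    · rw [if_pos hjl]
    · have : j.val ∉ Finset.Icc 1 k := fun h =>
        hj (Finset.mem_erase.2 ⟨fun h' => hjl (Fin.ext h'), h⟩)
      rw [if_neg hjl, spacingCoeff_of_notMem j this, sub_zero, div_self h0]

lemma sum_slabWeight_spacingCoeff_mul {q k : ℕ} (hk : k ≤ q) (g : ℝ → ℝ) :
    ∑ l, slabWeight (spacingCoeff q k) l * g (spacingCoeff q k l) =
      ∑ i ∈ Finset.Icc 1 k, cdfCoeff (q + 2) k i * g (cutoff (q + 2) k i) := by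
  refine sum_univ_fin_eq_sum_of_subset ?_ ?_ ?_
  · intro i hi
    have := (Finset.mem_Icc.1 hi).2
    omega
  · intro l hl
    rw [slabWeight_spacingCoeff hk l hl, spacingCoeff_of_mem l hl]
  · intro l hl
    rw [slabWeight, if_pos (spacingCoeff_of_notMem l hl), zero_mul]

lemma sum_cdfCoeff {q k : ℕ} (hk1 : 1 ≤ k) (hk : k ≤ q) :
    ∑ i ∈ Finset.Icc 1 k, cdfCoeff (q + 2) k i = 1 := by
  have h := sum_slabWeight_spacingCoeff_mul hk fun _ => 1
  simp only [mul_one] at h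
  rw [← h]
  refine sum_slabWeight (spacingCoeff_injective hk) ⟨⟨1, by omega⟩, ?_⟩
  have hmem : (⟨1, by omega⟩ : Fin (q + 2)).val ∈ Finset.Icc 1 k := by simp [hk1]
  rw [spacingCoeff_of_mem _ hmem]
  exact (cutoff_pos hk hmem).ne'

/-- An everywhere differentiable function that agrees with the distribution function of the sum
of the `k` smallest inner spacings of `N` points on the nonnegative half-line. -/
noncomputable def smoothCdf (N k : ℕ) (s : ℝ) : ℝ :=
  ∑ i ∈ Finset.Icc 1 k, cdfCoeff N k i * (1 - (max (1 - s / cutoff N k i) 0) ^ N)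

/-- The derivative of `smoothCdf`. -/
noncomputable def smoothPdf (N k : ℕ) (s : ℝ) : ℝ :=
  ∑ i ∈ Finset.Icc 1 k,
    cdfCoeff N k i * (N / cutoff N k i * (max (1 - s / cutoff N k i) 0) ^ (N - 1))

lemma continuous_smoothPdf (N k : ℕ) : Continuous (smoothPdf N k) := by
  unfold smoothPdf; fun_prop

lemma hasDerivAt_smoothCdf (q k : ℕ) (s : ℝ) :
    HasDerivAt (smoothCdf (q + 2) k) (smoothPdf (q + 2) k s) s := by
  refine HasDerivAt.fun_sum fun i _ => HasDerivAt.const_mul _ ?_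
  have h := (hasDerivAt_max_zero_pow_affine (n := q + 1) (by omega) 1
    (cutoff (q + 2) k i)⁻¹ s).const_sub 1
  simp only [inv_mul_eq_div] at h
  refine h.congr_deriv ?_
  rw [neg_neg, show q + 2 - 1 = q + 1 by omega]
  push_cast
  ring

lemma smoothCdf_zero (N k : ℕ) : smoothCdf N k 0 = 0 := by
  simp [smoothCdf]

theorem volume_innerSpacing_eq_smoothCdf {q k : ℕ} (hk1 : 1 ≤ k) (hk : k ≤ q) {s : ℝ}
    (hs : 0 ≤ s) : 0 ≤ smoothCdf (q + 2) k s ∧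
    volume {x : Fin (q + 2) → ℝ | (∀ i, x i ∈ Set.Icc (0 : ℝ) 1) ∧
      sumSmallest k (innerSpacing x) ≤ s} = ENNReal.ofReal (smoothCdf (q + 2) k s) := by
  obtain ⟨h1, h2⟩ := volume_slab (spacingCoeff_nonneg hk) (spacingCoeff_injective hk)
    (zero_le_one' ℝ) hs
  have hfac : (0 : ℝ) < ((q + 2)! : ℝ) := by exact_mod_cast Nat.factorial_pos _
  have hval : smoothCdf (q + 2) k s = ((q + 2)! : ℝ) * slabVol (spacingCoeff q k) 1 s := by
    rw [slabVol, mul_div_cancel₀ _ hfac.ne', one_pow,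
      sum_slabWeight_spacingCoeff_mul hk fun c => (max (1 - s / c) 0) ^ (q + 2), smoothCdf]
    simp only [mul_sub, mul_one, Finset.sum_sub_distrib, sum_cdfCoeff hk1 hk]
  refine ⟨hval ▸ mul_nonneg hfac.le h1, ?_⟩
  rw [volume_sumSmallest_innerSpacing_le (Nat.succ_pos q) (by omega : k ≤ q + 1) s, hval,
    ENNReal.ofReal_mul hfac.le, ENNReal.ofReal_natCast, ← h2]
  rfl

lemma sumSmallest_innerSpacing_nonneg {N : ℕ} (k : ℕ) (x : Fin N → ℝ) :
    0 ≤ sumSmallest k (innerSpacing x) := by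
  refine Finset.sum_nonneg fun j _ => sub_nonneg.2 ?_
  exact Tuple.monotone_sort x (by simp [Fin.le_def])

lemma smoothPdf_nonneg {q k : ℕ} (hk1 : 1 ≤ k) (hk : k ≤ q) {s : ℝ} (hs : 0 ≤ s) :
    0 ≤ smoothPdf (q + 2) k s := by
  have hmono : MonotoneOn (smoothCdf (q + 2) k) (Set.Ici 0) := by
    intro a ha b hb hab
    obtain ⟨-, ha2⟩ := volume_innerSpacing_eq_smoothCdf hk1 hk (Set.mem_Ici.1 ha)
    obtain ⟨hb1, hb2⟩ := volume_innerSpacing_eq_smoothCdf hk1 hk (Set.mem_Ici.1 hb)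
    rw [← ENNReal.ofReal_le_ofReal_iff hb1, ← ha2, ← hb2]
    exact measure_mono fun x hx => ⟨hx.1, hx.2.trans hab⟩
  have hd := (hasDerivAt_smoothCdf q k s).hasDerivWithinAt (s := Set.Ici 0)
  rw [← hd.derivWithin (uniqueDiffOn_Ici 0 s hs)]
  exact hmono.derivWithin_nonneg

lemma pow_mul_boxH {r s : ℝ} (hr : 0 < r) (hs : 0 ≤ s) {n : ℕ} (hn : n ≠ 0) :
    (1 - s / r) ^ n * boxH s 0 r = (max (1 - s / r) 0) ^ n := by
  rcases le_or_gt s r with h | h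
  · rw [boxH, Set.indicator_of_mem (Set.mem_Icc.2 ⟨hs, h⟩), mul_one,
      max_eq_left (sub_nonneg.2 ((div_le_one hr).2 h))]
  · rw [boxH, Set.indicator_of_notMem (fun h' => (not_le.2 h) h'.2), mul_zero,
      max_eq_right (sub_nonpos.2 ((one_le_div hr).2 h.le)), zero_pow hn]

lemma noEdgeCdf_eq_smoothCdf {q k : ℕ} (hk : k ≤ q) {s : ℝ} (hs : 0 ≤ s) :
    noEdgeCdf (q + 2) k s = smoothCdf (q + 2) k s := by
  rw [noEdgeCdf, smoothCdf, Finset.mul_sum]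
  refine Finset.sum_congr rfl fun i hi => ?_
  rw [← pow_mul_boxH (cutoff_pos hk hi) hs (by omega), cdfCoeff, cutoff, div_div_eq_mul_div,
    div_mul_eq_mul_div, mul_comm s]
  ring

lemma noEdgePdf_eq_smoothPdf {q k : ℕ} (hk : k ≤ q) {s : ℝ} (hs : 0 ≤ s) :
    noEdgePdf (q + 2) k s = smoothPdf (q + 2) k s := by
  rw [noEdgePdf, smoothPdf, Finset.mul_sum]
  refine Finset.sum_congr rfl fun i hi => ?_
  have h1 : (i : ℝ) ≤ k := by exact_mod_cast (Finset.mem_Icc.1 hi).2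
  have h3 : (k : ℝ) ≤ q := by exact_mod_cast hk
  have h4 : ((q + 2 : ℕ) : ℝ) - i ≠ 0 := by push_cast; linarith
  have hb : (k : ℝ) + 1 - i ≠ 0 := by linarith
  have hsr : ((q + 2 : ℕ) - i : ℝ) / ((k : ℝ) + 1 - i) * s =
      s / (((k : ℝ) + 1 - i) / ((q + 2 : ℕ) - i)) := by
    field_simp
  rw [← pow_mul_boxH (cutoff_pos hk hi) hs (by omega), cdfCoeff, cutoff, hsr]
  field_simp

lemma noEdgePdf_of_neg (N k : ℕ) {s : ℝ} (hs : s < 0) : noEdgePdf N k s = 0 := by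
  rw [noEdgePdf, Finset.sum_eq_zero, mul_zero]
  intro i _
  rw [boxH, Set.indicator_of_notMem (fun h => (not_le.2 hs) h.1), mul_zero]

lemma integral_Icc_one_sub_mul_pow (n : ℕ) (a : ℝ) :
    ∫ m in Set.Icc a 1, (1 - m) * (m - a) ^ n =
      (max (1 - a) 0) ^ (n + 2) / ((n + 1) * (n + 2)) := by
  rcases le_or_gt a 1 with h | h
  · rw [max_eq_left (by linarith), integral_Icc_eq_integral_Ioc,
      ← intervalIntegral.integral_of_le h]
    have hn1 : (n + 1 : ℝ) ≠ 0 := by positivity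
    have hn2 : (n + 2 : ℝ) ≠ 0 := by positivity
    have hd : ∀ m ∈ Set.uIcc a 1, HasDerivAt (fun m : ℝ =>
        (1 - a) * (m - a) ^ (n + 1) / (n + 1) - (m - a) ^ (n + 2) / (n + 2))
        ((1 - m) * (m - a) ^ n) m := by
      intro m _
      have h1 := (((hasDerivAt_id m).sub_const a).pow (n + 1)).const_mul (1 - a)
      have h2 := ((hasDerivAt_id m).sub_const a).pow (n + 2)
      refine ((h1.div_const (n + 1 : ℝ)).sub (h2.div_const (n + 2 : ℝ))).congr_deriv ?_
      simp only [id, Nat.add_sub_cancel, show n + 2 - 1 = n + 1 by omega]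
      push_cast
      field_simp
      ring
    rw [intervalIntegral.integral_eq_sub_of_hasDerivAt hd
      (Continuous.intervalIntegrable (by fun_prop) _ _)]
    simp only [sub_self, zero_pow (Nat.succ_ne_zero _), mul_zero, zero_div, sub_zero]
    field_simp
    ring
  · rw [Set.Icc_eq_empty (not_le.2 h), Measure.restrict_empty, integral_zero_measure,
      max_eq_right (by linarith), zero_pow (by omega), zero_div]

lemma noEdgePdfIntegral_eq_smoothPdf {q k : ℕ} (hk1 : 1 ≤ k) (hk : k ≤ q) (s : ℝ) :
    noEdgePdfIntegral (q + 2) k s = smoothPdf (q + 2) k s := by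
  obtain ⟨p, rfl⟩ : ∃ p, q = p + 1 := ⟨q - 1, by omega⟩
  rw [noEdgePdfIntegral, smoothPdf, Finset.mul_sum]
  refine Finset.sum_congr rfl fun i hi => ?_
  have h1 : (i : ℝ) ≤ k := by exact_mod_cast (Finset.mem_Icc.1 hi).2
  have h3 : (k : ℝ) ≤ p + 1 := by exact_mod_cast hk
  have h4 : ((p + 1 + 2 : ℕ) : ℝ) - i ≠ 0 := by push_cast; linarith
  have hb : (k : ℝ) + 1 - i ≠ 0 := by linarith
  have hsr : ((p + 1 + 2 : ℕ) - i : ℝ) / ((k : ℝ) + 1 - i) * s =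
      s / cutoff (p + 1 + 2) k i := by
    rw [cutoff]; field_simp
  have hsr' : (((p + 1 + 2 : ℕ) - i : ℝ) * s) / ((k : ℝ) + 1 - i) =
      s / cutoff (p + 1 + 2) k i := by
    rw [cutoff]; field_simp
  simp only [hsr, hsr', mul_assoc (coeffa i k)]
  rw [integral_const_mul, show p + 1 + 2 - 3 = p by omega, integral_Icc_one_sub_mul_pow,
    show p + 1 + 2 - 1 = p + 2 by omega, cdfCoeff]
  generalize (max (1 - s / cutoff (p + 1 + 2) k i) 0) ^ (p + 2) = T
  rw [cutoff]
  have hp1 : (p + 1 : ℝ) ≠ 0 := by positivity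
  have hp2 : (p + 2 : ℝ) ≠ 0 := by positivity
  have e1 : ((p + 1 + 2 : ℕ) : ℝ) - 2 = p + 1 := by push_cast; ring
  have e2 : ((p + 1 + 2 : ℕ) : ℝ) - 1 = p + 2 := by push_cast; ring
  rw [e1, e2]
  field_simp

lemma map_eq_restrict_cube {Ω : Type*} [MeasurableSpace Ω] {P : Measure Ω} [IsProbabilityMeasure P]
    {N : ℕ} {X : Fin N → Ω → ℝ} (hindep : iIndepFun X P)
    (hunif : ∀ i, pdf.IsUniform (X i) (Set.Icc (0 : ℝ) 1) P volume) :
    (∀ i, AEMeasurable (X i) P) ∧ P.map (fun ω i => X i ω) =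
      volume.restrict {x : Fin N → ℝ | ∀ i, x i ∈ Set.Icc (0 : ℝ) 1} := by
  have hmeas : ∀ i, AEMeasurable (X i) P := fun i =>
    (hunif i).aemeasurable (by simp) (by simp)
  have hmap : ∀ i, P.map (X i) = volume.restrict (Set.Icc (0 : ℝ) 1) := fun i => by
    rw [hunif i, ProbabilityTheory.cond]
    simp
  refine ⟨hmeas, ?_⟩
  rw [(iIndepFun_iff_map_fun_eq_pi_map hmeas).1 hindep]
  simp_rw [hmap]
  rw [← Measure.restrict_pi_pi, volume_pi]
  congr 1
  ext x
  simp only [Set.mem_univ_pi, Set.mem_ofPred_eq]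

theorem mainTheorem4 {Ω : Type*} [MeasurableSpace Ω] (P : Measure Ω) [IsProbabilityMeasure P]
    (N k : ℕ) (hk : 1 ≤ k) (hkN : k + 2 ≤ N)
    (X : Fin N → Ω → ℝ) (hindep : iIndepFun X P)
    (hunif : ∀ i, pdf.IsUniform (X i) (Set.Icc (0 : ℝ) 1) P volume) :
    (∀ s : ℝ, 0 ≤ noEdgePdf N k s) ∧
    P.map (fun ω => sumSmallest k (innerSpacing (fun i => X i ω))) =
      volume.withDensity (fun s => ENNReal.ofReal (noEdgePdf N k s)) ∧
    (∀ s : ℝ, 0 ≤ s → noEdgePdf N k s = noEdgePdfIntegral N k s) ∧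
    (∀ s : ℝ, 0 ≤ s →
      P.real {ω | sumSmallest k (innerSpacing (fun i => X i ω)) ≤ s} = noEdgeCdf N k s) ∧
    (∀ s : ℝ, s < 0 →
      P.real {ω | sumSmallest k (innerSpacing (fun i => X i ω)) ≤ s} = 0) := by
  obtain ⟨q, rfl⟩ : ∃ q, N = q + 2 := ⟨N - 2, by omega⟩
  have hkq : k ≤ q := by omega
  obtain ⟨hXm, hmap⟩ := map_eq_restrict_cube hindep hunif
  have hstat : Measurable fun x : Fin (q + 2) → ℝ => sumSmallest k (innerSpacing x) :=
    (measurable_sumSmallest _ _).comp (measurable_innerSpacing _)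
  have hvec : AEMeasurable (fun ω i => X i ω) P := aemeasurable_pi_lambda _ hXm
  have hprob : ∀ s : ℝ, P {ω | sumSmallest k (innerSpacing (fun i => X i ω)) ≤ s} =
      volume {x : Fin (q + 2) → ℝ | (∀ i, x i ∈ Set.Icc (0 : ℝ) 1) ∧
        sumSmallest k (innerSpacing x) ≤ s} := by
    intro s
    have hS : MeasurableSet {x : Fin (q + 2) → ℝ | sumSmallest k (innerSpacing x) ≤ s} :=
      measurableSet_le hstat measurable_const
    have h := Measure.map_apply_of_aemeasurable hvec hS
    rw [hmap, Measure.restrict_apply hS] at h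
    rw [Set.inter_comm] at h
    exact h.symm
  have hpos : ∀ s : ℝ, 0 ≤ s → P {ω | sumSmallest k (innerSpacing (fun i => X i ω)) ≤ s} =
      ENNReal.ofReal (smoothCdf (q + 2) k s) := fun s hs =>
    (hprob s).trans (volume_innerSpacing_eq_smoothCdf hk hkq hs).2
  have hneg : ∀ s : ℝ, s < 0 → P {ω | sumSmallest k (innerSpacing (fun i => X i ω)) ≤ s} = 0 := by
    intro s hs
    have : {ω | sumSmallest k (innerSpacing (fun i => X i ω)) ≤ s} = ∅ :=
      Set.eq_empty_of_forall_notMem fun ω hω =>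
        not_le.2 hs ((sumSmallest_innerSpacing_nonneg k _).trans hω)
    rw [this, measure_empty]
  have hpdf : ∀ s : ℝ, 0 ≤ noEdgePdf (q + 2) k s := by
    intro s
    rcases lt_or_ge s 0 with hs | hs
    · rw [noEdgePdf_of_neg _ _ hs]
    · rw [noEdgePdf_eq_smoothPdf hkq hs]
      exact smoothPdf_nonneg hk hkq hs
  refine ⟨hpdf, ?_, fun s hs => ?_, fun s hs => ?_, fun s hs => ?_⟩
  · have hae : AEMeasurable (fun ω => sumSmallest k (innerSpacing (fun i => X i ω))) P :=
      hstat.comp_aemeasurable hvec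
    have : IsProbabilityMeasure
        (P.map fun ω => sumSmallest k (innerSpacing (fun i => X i ω))) :=
      Measure.isProbabilityMeasure_map hae
    refine Measure.ext_of_Iic _ _ fun s => ?_
    rw [Measure.map_apply_of_aemeasurable hae measurableSet_Iic,
      withDensity_apply _ measurableSet_Iic]
    change P {ω | sumSmallest k (innerSpacing (fun i => X i ω)) ≤ s} = _
    have hind : ∀ u, (Set.Iic s).indicator
        (fun u => ENNReal.ofReal (noEdgePdf (q + 2) k u)) u =
        (Set.Icc 0 s).indicator (fun u => ENNReal.ofReal (smoothPdf (q + 2) k u)) u := by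
      intro u
      rcases lt_or_ge u 0 with hu | hu
      · rw [Set.indicator_of_notMem (s := Set.Icc 0 s) (fun h => not_le.2 hu h.1)]
        refine Set.indicator_apply_eq_zero.2 fun _ => ?_
        rw [noEdgePdf_of_neg _ _ hu, ENNReal.ofReal_zero]
      · simp only [Set.indicator, Set.mem_Iic, Set.mem_Icc, hu, true_and,
          noEdgePdf_eq_smoothPdf hkq hu]
    rw [← lintegral_indicator measurableSet_Iic, lintegral_congr hind,
      lintegral_indicator measurableSet_Icc]
    rcases lt_or_ge s 0 with hs | hs
    · rw [hneg s hs, Set.Icc_eq_empty (not_le.2 hs), Measure.restrict_empty,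
        lintegral_zero_measure]
    · have hcont := continuous_smoothPdf (q + 2) k
      rw [hpos s hs, ← ofReal_integral_eq_lintegral_ofReal hcont.integrableOn_Icc
        ((ae_restrict_iff' measurableSet_Icc).2 (Filter.Eventually.of_forall
          fun u hu => smoothPdf_nonneg hk hkq hu.1)), integral_Icc_eq_integral_Ioc,
        ← intervalIntegral.integral_of_le hs,
        intervalIntegral.integral_eq_sub_of_hasDerivAt
          (fun u _ => hasDerivAt_smoothCdf q k u) (hcont.intervalIntegrable _ _),
        smoothCdf_zero, sub_zero]
  · rw [noEdgePdf_eq_smoothPdf hkq hs, noEdgePdfIntegral_eq_smoothPdf hk hkq]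
  · rw [measureReal_def, hpos s hs, ENNReal.toReal_ofReal
      (volume_innerSpacing_eq_smoothCdf hk hkq hs).1, noEdgeCdf_eq_smoothCdf hkq hs]
  · rw [measureReal_def, hneg s hs, ENNReal.toReal_zero]
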